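/- Let $n\ge 1$, let $M\in\mathbb{R}^{n\times n}$ be a matrix each of whose columns is nonpositive and has at least one negative entry, and let $q\in\mathbb{R}^n$ have positive entries. The Nash equilibrium complementarity problem (NECP) asks for $w,z\in\mathbb{R}^n$ with $w=Mz+q$, $w^\top z=0$, $z\neq 0$, $w,z\ge 0$. Write its linear constraints as $Ax=q$, $x=\binom{w}{z}\ge 0$ with $A=(I\ \ {-M})$, whose columns are indexed by $[n]\uplus[n]=([n]\times\{\mathrm{blue}\})\cup([n]\times\{\mathrm{red}\})$ (blue for $w$, red for $z$). The label of $(k,\text{color})$ is $k$, and $(k,\mathrm{blue})$, $(k,\mathrm{red})$ are twins. *Logarithmic image.* Let $\mathbb{T}=\mathbb{R}\cup\{-\infty\}$ be the max-plus semifield. The logarithmic image is the tropical instance $w\oplus \log(-M)\odot z=\log q$, i.e. $\bar A\odot\binom{w}{z}=\bar b$ with $\bar A=\log A$, $\bar b=\log q$ (entrywise, $\log 0=-\infty$). *Bases.* A feasible basis of $Ax=q$, $x\ge0$ is a set $B$ of columns such that $A_B$ is a nonsingular square matrix and the basic solution (the unique $x$ with $Ax=q$ and support in $B$) is nonnegative;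 it is nondegenerate if the support of the basic solution is $B$. A tropical basis of $\bar A\odot x=\bar b$ is a set $B$ of columns admitting a bijection $\phi:[n]\to B$ such that for each $i$ the quantity $\bar b_i-\bar A_{i\phi(i)}$ is not $+\infty$ and is minimal among the $\bar b_k-\bar A_{k\phi(i)}$, $k\in[n]$ (with $\lambda-(-\infty)=+\infty$); it is nondegenerate if for each $j\in B$ the minimum $\min_k(\bar b_k-\bar A_{kj})$ is real and attained exactly once. A system is nondegenerate if all its feasible (resp. tropical) bases are. *Dominance condition.* Let $C=\operatorname{diag}(q)^{-1}A\operatorname{diag}(u)^{-1}$, where $u_j$ is the largest entry of the $j$th column of $\operatorname{diag}(q)^{-1}A$. The instance satisfies the dominance condition if some $n\times n$ submatrix of $C$ is entrywise at least some permutation matrix, and in every $n\times n$ submatrix of $C$ that is entrywise at least some permutation matrix, each row has sum less than $2$. *Lemke--Howson algorithm.* Fix $j^\star\in[n]$. Start with the basis $B=[n]\uplus\varnothing$ (all blue columns) and $\gamma=(j^\star,\mathrm{red})$. In each iteration, let $B'$ be the unique basis (feasible basis in the classical case, tropical basis in the tropical case) included in $B\cup\{\gamma\}$ and distinct from $B$,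 replace $\gamma$ by the twin of the unique element of $B\setminus B'$, replace $B$ by $B'$, and stop, returning $B$, if every label in $[n]$ appears in $B$. **Theorem.** Suppose that the instance $(M,q)$ of NECP satisfies the dominance condition. Then the classical system and its logarithmic image are both nondegenerate, and for every $j^\star\in[n]$ the Lemke--Howson algorithm is well defined on both and terminates on both; the sequence of bases that it visits is the same for the classical instance and for its logarithmic image; the number of iterations is at most $2n-1$; and it returns a feasible basis of the classical system whose basic solution $(w,z)$ is a solution of the NECP instance. -/

import Mathlib

namespace NashCP

/-! ### Instances and solutions of the Nash equilibrium complementarity problem -/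

/-- Standing conditions on the data: every column of `M` is nonpositive and has a negative entry,
and every entry of `q` is positive. -/
structure IsInstance {n : ℕ} (M : Matrix (Fin n) (Fin n) ℝ) (q : Fin n → ℝ) : Prop where
  nonpos : ∀ i j, M i j ≤ 0
  exists_neg : ∀ j, ∃ i, M i j < 0
  pos : ∀ i, 0 < q i

/-- `(w, z)` solves `w = M z + q`, `wᵀ z = 0`, `z ≠ 0`, `w, z ≥ 0`. -/
structure IsSolution {n : ℕ} (M : Matrix (Fin n) (Fin n) ℝ) (q w z : Fin n → ℝ) : Prop where
  eq : w = M.mulVec z + q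
  compl : dotProduct w z = 0
  ne_zero : z ≠ 0
  nonneg_w : 0 ≤ w
  nonneg_z : 0 ≤ z

/-- The matrix `(I  -M)`. Its columns are indexed by the disjoint union of two copies of `[n]`:
`Sum.inl` is the blue copy (variables `w`), `Sum.inr` is the red copy (variables `z`). -/
def slackMatrix {n : ℕ} (M : Matrix (Fin n) (Fin n) ℝ) : Matrix (Fin n) (Fin n ⊕ Fin n) ℝ :=
  Matrix.fromCols 1 (-M)

/-! ### Feasible bases of a system `A x = b`, `x ≥ 0` -/

/-- The columns of `A` indexed by `B` form a nonsingular square matrix. -/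
def IsBasis {n : ℕ} {κ : Type*} (A : Matrix (Fin n) κ ℝ) (B : Finset κ) : Prop :=
  ∃ e : Fin n ≃ {j // j ∈ B}, IsUnit (A.submatrix id (fun k => (e k : κ))).det

/-- `x` is a point with `A x = b` whose support is included in `B`
(for a basis `B` there is exactly one such point). -/
def IsBasicSolution {n : ℕ} {κ : Type*} [Fintype κ] (A : Matrix (Fin n) κ ℝ) (b : Fin n → ℝ)
    (B : Finset κ) (x : κ → ℝ) : Prop :=
  A.mulVec x = b ∧ ∀ j, x j ≠ 0 → j ∈ B

/-- `B` is a basis whose basic solution is nonnegative. -/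
def IsFeasibleBasis {n : ℕ} {κ : Type*} [Fintype κ] (A : Matrix (Fin n) κ ℝ) (b : Fin n → ℝ)
    (B : Finset κ) : Prop :=
  IsBasis A B ∧ ∃ x, IsBasicSolution A b B x ∧ 0 ≤ x

/-- Every feasible basis is nondegenerate: the support of its basic solution is the whole basis. -/
def IsNondegenerate {n : ℕ} {κ : Type*} [Fintype κ] (A : Matrix (Fin n) κ ℝ)
    (b : Fin n → ℝ) : Prop :=
  ∀ B, IsFeasibleBasis A b B → ∀ x, IsBasicSolution A b B x → ∀ j, x j ≠ 0 ↔ j ∈ B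

/-! ### The dominance condition -/

/-- `C - D` is a nonnegative matrix. -/
def Covers {n m : Type*} (C D : Matrix n m ℝ) : Prop :=
  ∀ i j, 0 ≤ (C - D) i j

/-- Entries in `[0, 1]`, and an entry equal to `1` in every column. -/
def IsColumnwiseNormal {n : ℕ} {κ : Type*} (C : Matrix (Fin n) κ ℝ) : Prop :=
  (∀ i j, C i j ∈ Set.Icc (0 : ℝ) 1) ∧ ∀ j, ∃ i, C i j = 1

/-- The `n × n` submatrix with columns `f 0, …, f (n - 1)` covers a permutation matrix. -/
def SubmatrixCoversPerm {n : ℕ} {κ : Type*} (C : Matrix (Fin n) κ ℝ) (f : Fin n ↪ κ) : Prop :=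
  ∃ σ : Equiv.Perm (Fin n), Covers (C.submatrix id f) (σ.permMatrix ℝ)

/-- The dominance condition for a columnwise normal matrix. -/
def MatrixDominance {n : ℕ} {κ : Type*} (C : Matrix (Fin n) κ ℝ) : Prop :=
  IsColumnwiseNormal C ∧
  (∃ f : Fin n ↪ κ, SubmatrixCoversPerm C f) ∧
  ∀ f : Fin n ↪ κ, SubmatrixCoversPerm C f → ∀ i, ∑ k, C i (f k) < 2

/-- The normalized matrix `diag(b)⁻¹ A diag(u)⁻¹`, with `u j` the largest entry of the `j`-th column
of `diag(b)⁻¹ A`. -/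
noncomputable def normalized {n : ℕ} {κ : Type*} (A : Matrix (Fin n) κ ℝ) (b : Fin n → ℝ) :
    Matrix (Fin n) κ ℝ :=
  Matrix.of fun i j => (b i)⁻¹ * A i j * (⨆ k, (b k)⁻¹ * A k j)⁻¹

/-- The dominance condition for the system `A x = b`, `x ≥ 0`. -/
def SystemDominance {n : ℕ} {κ : Type*} (A : Matrix (Fin n) κ ℝ) (b : Fin n → ℝ) : Prop :=
  MatrixDominance (normalized A b)

/-! ### Tropical systems `A ⊙ x = b` over the max-plus semifield `ℝ ∪ {-∞}` -/

/-- The difference `b - a` of two tropical numbers, in `[-∞, +∞]`, with `b - (-∞) = +∞` for all `b`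
(in particular `(-∞) - (-∞) = +∞`). -/
noncomputable def tropSub : WithBot ℝ → WithBot ℝ → EReal
  | _, ⊥ => ⊤
  | ⊥, (_ : ℝ) => ⊥
  | (b : ℝ), (a : ℝ) => ((b - a : ℝ) : EReal)

/-- `B` is a tropical basis of `A ⊙ x = b`: there is a bijection `φ` from the rows to `B` such that
`b i - A i (φ i)` is not `+∞` and is minimal among the `b k - A k (φ i)`. -/
def IsTropicalBasis {n : ℕ} {κ : Type*} (A : Matrix (Fin n) κ (WithBot ℝ))
    (b : Fin n → WithBot ℝ) (B : Finset κ) : Prop :=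
  ∃ φ : Fin n ≃ {j // j ∈ B}, ∀ i,
    tropSub (b i) (A i (φ i)) ≠ ⊤ ∧
    ∀ k, tropSub (b i) (A i (φ i)) ≤ tropSub (b k) (A k (φ i))

/-- Every tropical basis `B` is nondegenerate: for each column `j ∈ B`, the minimum of the
`b k - A k j` is a real number and is attained exactly once. -/
def IsTropicallyNondegenerate {n : ℕ} {κ : Type*} (A : Matrix (Fin n) κ (WithBot ℝ))
    (b : Fin n → WithBot ℝ) : Prop :=
  ∀ B, IsTropicalBasis A b B → ∀ j ∈ B, ∃ i,
    tropSub (b i) (A i j) ≠ ⊥ ∧ tropSub (b i) (A i j) ≠ ⊤ ∧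
    ∀ k, k ≠ i → tropSub (b i) (A i j) < tropSub (b k) (A k j)

/-- The logarithm `[0, +∞) → ℝ ∪ {-∞}`, with `log 0 = -∞`. -/
noncomputable def tropLog (x : ℝ) : WithBot ℝ :=
  if x ≤ 0 then ⊥ else ((Real.log x : ℝ) : WithBot ℝ)

/-- The tropical matrix `(I  N)`, where the tropical identity has `0` on the diagonal
and `-∞` elsewhere. -/
def tropSlackMatrix {n : ℕ} (N : Matrix (Fin n) (Fin n) (WithBot ℝ)) :
    Matrix (Fin n) (Fin n ⊕ Fin n) (WithBot ℝ) :=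
  Matrix.fromCols (Matrix.of fun i j => if i = j then ((0 : ℝ) : WithBot ℝ) else ⊥) N

/-- The matrix `log (-M)` of the logarithmic image. -/
noncomputable def logMatrix {n : ℕ} (M : Matrix (Fin n) (Fin n) ℝ) :
    Matrix (Fin n) (Fin n) (WithBot ℝ) :=
  (-M).map tropLog

/-- The vector `log q` of the logarithmic image. -/
noncomputable def logVector {n : ℕ} (q : Fin n → ℝ) : Fin n → WithBot ℝ :=
  fun i => tropLog (q i)

/-! ### The Lemke--Howson algorithm

It is defined relative to a notion of (feasible) basis `P`, so that exactly the same procedure is run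
on classical and on tropical systems. The twin of an element of `[n] ⊎ [n]` is given by
`Sum.swap`. -/

/-- Every label `k` appears in `B` with at least one of the two colors. -/
def FullyLabeled {n : ℕ} (B : Finset (Fin n ⊕ Fin n)) : Prop :=
  ∀ k, Sum.inl k ∈ B ∨ Sum.inr k ∈ B

/-- The pivot operation from `B` with entering element `γ` is well defined, leads to `B'`, and makes
`δ` leave: `B'` is the unique basis included in `B ∪ {γ}` and distinct from `B`, and `δ` is the unique
element of `B \ B'`. -/
def Pivot {n : ℕ} (P : Finset (Fin n ⊕ Fin n) → Prop)
    (B : Finset (Fin n ⊕ Fin n)) (γ : Fin n ⊕ Fin n)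
    (B' : Finset (Fin n ⊕ Fin n)) (δ : Fin n ⊕ Fin n) : Prop :=
  (∀ B'', (P B'' ∧ B'' ⊆ insert γ B ∧ B'' ≠ B) ↔ B'' = B') ∧ B \ B' = {δ}

/-- `Loop P B γ L`: the loop of the algorithm, entered with current basis `B` and entering element
`γ`, performs `L.length` iterations and stops; `L` lists the bases obtained after each iteration. -/
inductive Loop {n : ℕ} (P : Finset (Fin n ⊕ Fin n) → Prop) :
    Finset (Fin n ⊕ Fin n) → Fin n ⊕ Fin n → List (Finset (Fin n ⊕ Fin n)) → Prop
  | halt {B γ B' δ} : Pivot P B γ B' δ → FullyLabeled B' → Loop P B γ [B']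
  | next {B γ B' δ L} : Pivot P B γ B' δ → ¬ FullyLabeled B' →
      Loop P B' δ.swap L → Loop P B γ (B' :: L)

/-- The initial basis `[n] ⊎ ∅`. -/
def initialBasis (n : ℕ) : Finset (Fin n ⊕ Fin n) :=
  Finset.univ.map Function.Embedding.inl

/-- The Lemke--Howson algorithm with parameter `jstar`, run with the bases given by `P`, terminates
after `L.length` iterations, visiting the initial basis and then successively the elements of `L`. -/
def LemkeHowson {n : ℕ} (P : Finset (Fin n ⊕ Fin n) → Prop) (jstar : Fin n)
    (L : List (Finset (Fin n ⊕ Fin n))) : Prop :=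
  P (initialBasis n) ∧ Loop P (initialBasis n) (Sum.inr jstar) L

end NashCP

open NashCP

open NashCP

namespace NashCP

/-! ### Dominant systems -/

/-! Scaling rows by `b` and columns by `u` reduces the system to `C y = 1` with `y j = u j * x j`,
where column `j` of `C` has its entry `1` in row `c j`. Dominance says that, for every section of
`c`, the off-diagonal entries in each row of the chosen square submatrix have sum less than `1`.
Everything then depends on `c` alone.

A feasible basis must meet every fiber of `c`: the weight of `y` on each fiber is at most `1`, so a
row whose fiber is missed would have total less than `1`. Conversely, a section of `c` gives a
strictly diagonally dominant matrix with a positive basic solution. Tropically, the minimum for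
column `j` is attained only at row `c j`. Hence feasible and tropical bases are both exactly the
transversals of `c` (`feasible_iff`, `tropicalBasis_iff`), and both runs of the algorithm coincide.

On transversals, an entering `γ` evicts the element occupying row `c γ` (`pivot_update`). Blue `k`
belongs to row `k`, so the red columns entering follow the orbit `p` of `jstar` under `k ↦ c (inr
k)`. If the orbit returns to `jstar`, the algorithm stops there. If it first meets a later orbit
point, it retraces the initial tail, blue columns replacing red ones (`reaches_forward`,
`reaches_walk_back`). A red column survives, so `z ≠ 0`, and full labeling gives complementarity. -/

/-- `A = diag(b) C diag(u)` with `b, u > 0` and `C` columnwise normal with an entry equal to `1` at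
position `c j` of each column `j`, such that the rows of the submatrices of `C` given by the sections
of `c` have sums less than `2`. -/
structure IsDominant {n : ℕ} {κ : Type*} (A : Matrix (Fin n) κ ℝ) (b : Fin n → ℝ)
    (C : Matrix (Fin n) κ ℝ) (u : κ → ℝ) (c : κ → Fin n) : Prop where
  b_pos : ∀ i, 0 < b i
  u_pos : ∀ j, 0 < u j
  eq : ∀ i j, A i j = b i * C i j * u j
  nonneg : ∀ i j, 0 ≤ C i j
  le_one : ∀ i j, C i j ≤ 1
  eq_one : ∀ j, C (c j) j = 1
  surj : Function.Surjective c
  sum_lt : ∀ g : Fin n → κ, (∀ i, c (g i) = i) → ∀ i, ∑ k, C i (g k) < 2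

/-- `B` contains exactly one element of each fiber of `c`. -/
def Transversal {n : ℕ} {κ : Type*} (c : κ → Fin n) (B : Finset κ) : Prop :=
  ∃ g : Fin n → κ, (∀ i, c (g i) = i) ∧ ∀ j, j ∈ B ↔ g (c j) = j

/-- A system `(1 + R) y = 1` with `R` nonnegative and of row sums less than `1` has only positive
solutions. -/
theorem pos_of_mulVec_eq_one {n : ℕ} {D : Matrix (Fin n) (Fin n) ℝ} (h0 : ∀ i j, 0 ≤ D i j)
    (h1 : ∀ i, D i i = 1) (h2 : ∀ i, ∑ j, D i j < 2) {y : Fin n → ℝ}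
    (hy : ∀ i, ∑ j, D i j * y j = 1) (i : Fin n) : 0 < y i := by
  have : Nonempty (Fin n) := ⟨i⟩
  obtain ⟨m, hm⟩ := Finite.exists_min y
  obtain ⟨M, hM⟩ := Finite.exists_max y
  refine lt_of_lt_of_le ?_ (hm i)
  have split : ∀ k, y k = 1 - ∑ j ∈ Finset.univ.erase k, D k j * y j := fun k => by
    have := hy k
    rw [← Finset.add_sum_erase _ _ (Finset.mem_univ k), h1] at this
    linarith
  have row : ∀ k, ∑ j ∈ Finset.univ.erase k, D k j < 1 := fun k => by
    have := h2 k
    rw [← Finset.add_sum_erase _ _ (Finset.mem_univ k), h1] at this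
    linarith
  have row0 : ∀ k, 0 ≤ ∑ j ∈ Finset.univ.erase k, D k j := fun k =>
    Finset.sum_nonneg fun j _ => h0 k j
  -- The extremes of `y` bound each other: `y m ≥ 1 - r * y M` and `y M ≤ 1 - s * y m`, hence `(1 -
  -- r * s) * y m ≥ 1 - r > 0`.
  have e1 : 1 - (∑ j ∈ Finset.univ.erase m, D m j) * y M ≤ y m := by
    rw [split m, Finset.sum_mul]
    gcongr with j
    · exact h0 m j
    · exact hM j
  have e2 : y M ≤ 1 - (∑ j ∈ Finset.univ.erase M, D M j) * y m := by
    conv_lhs => rw [split M]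
    rw [Finset.sum_mul]
    gcongr with j
    · exact h0 M j
    · exact hm j
  have r1 := row m
  have r2 := row M
  have p1 := row0 m
  have p2 := row0 M
  generalize ∑ j ∈ Finset.univ.erase m, D m j = r at *
  generalize ∑ j ∈ Finset.univ.erase M, D M j = s at *
  have e3 := mul_le_mul_of_nonneg_left e2 p1
  have e4 : r * s < 1 := by nlinarith
  by_contra h
  have e5 : (1 - r * s) * y m ≤ 0 := mul_nonpos_of_nonneg_of_nonpos (by linarith) (not_lt.1 h)
  nlinarith

/-! ### Feasible bases as transversals -/

namespace IsDominant

variable {n : ℕ} {κ : Type*} {A : Matrix (Fin n) κ ℝ} {b : Fin n → ℝ}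
  {C : Matrix (Fin n) κ ℝ} {u : κ → ℝ} {c : κ → Fin n}

theorem sum_erase_lt (h : IsDominant A b C u c) {g : Fin n → κ} (hg : ∀ i, c (g i) = i)
    (i : Fin n) : ∑ k ∈ Finset.univ.erase i, C i (g k) < 1 := by
  have h2 := h.sum_lt g hg i
  have h1 := h.eq_one (g i)
  rw [hg] at h1
  rw [← Finset.add_sum_erase _ _ (Finset.mem_univ i), h1] at h2
  linarith

/-- Any section can be modified to pass through `j`; then `C i j` is one of the off-diagonal terms
of row `i`, whose sum is less than `1`. Thus the entry `1` of a column is unique. -/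
theorem lt_one (h : IsDominant A b C u c) {i : Fin n} {j : κ} (hij : i ≠ c j) : C i j < 1 := by
  obtain ⟨g, hg⟩ := h.surj.hasRightInverse
  have hg' : ∀ k, c (Function.update g (c j) j k) = k := fun k => by
    by_cases hk : k = c j
    · subst hk; simp
    · simp [hk, hg k]
  refine lt_of_le_of_lt ?_ (h.sum_erase_lt hg' i)
  have := Finset.single_le_sum (f := fun k => C i (Function.update g (c j) j k))
    (fun k _ => h.nonneg _ _) (Finset.mem_erase.2 ⟨hij.symm, Finset.mem_univ (c j)⟩)
  simpa using this

theorem transversal_of_feasible [Fintype κ] (h : IsDominant A b C u c) {B : Finset κ}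
    (hB : IsFeasibleBasis A b B) : Transversal c B := by
  classical
  obtain ⟨⟨e, -⟩, x, ⟨hx, hxB⟩, hx0⟩ := hB
  have hy : ∀ i, ∑ j, C i j * (u j * x j) = 1 := fun i => by
    have h1 := congrFun hx i
    simp only [Matrix.mulVec, dotProduct, h.eq, mul_assoc, ← Finset.mul_sum] at h1
    exact mul_left_cancel₀ (h.b_pos i).ne' (h1.trans (mul_one _).symm)
  have hy0 : ∀ j, 0 ≤ u j * x j := fun j => mul_nonneg (h.u_pos j).le (hx0 j)
  -- In row `i` every column of the fiber over `i` has coefficient `1`, so the fiber weight is at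
  -- most the whole row, which equals `1`.
  have hs : ∀ i, ∑ j with c j = i, u j * x j ≤ 1 := fun i => by
    rw [← hy i]
    calc ∑ j with c j = i, u j * x j = ∑ j with c j = i, C i j * (u j * x j) := by
          refine Finset.sum_congr rfl fun j hj => ?_
          obtain rfl := (Finset.mem_filter.1 hj).2
          rw [h.eq_one, one_mul]
      _ ≤ _ := Finset.sum_le_sum_of_subset_of_nonneg (Finset.filter_subset _ _)
          fun j _ _ => mul_nonneg (h.nonneg _ _) (hy0 j)
  have key : ∀ i, ∃ j ∈ B, c j = i := by
    intro i
    by_contra! hi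
    have hmax : ∀ k, ∃ j, c j = k ∧ ∀ j', c j' = k → C i j' ≤ C i j := fun k => by
      have hne : (Finset.univ.filter fun j => c j = k).Nonempty := by
        obtain ⟨j, hj⟩ := h.surj k
        exact ⟨j, by simpa using hj⟩
      obtain ⟨j, hj, hmax⟩ := Finset.exists_max_image _ (C i) hne
      exact ⟨j, by simpa using hj, fun j' hj' => hmax j' (by simpa using hj')⟩
    -- This section picks, in each fiber, the column with the largest entry in the missed row `i`;
    -- it bounds that row by `∑ k ≠ i, C i (g k) < 1`.
    choose g hg hgm using hmax
    have h1 : ∑ j, C i j * (u j * x j) ≤ ∑ k ∈ Finset.univ.erase i, C i (g k) := by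
      rw [← Finset.sum_fiberwise Finset.univ c, ← Finset.add_sum_erase _ _ (Finset.mem_univ i),
        Finset.sum_eq_zero, zero_add]
      · refine Finset.sum_le_sum fun k _ => ?_
        calc ∑ j with c j = k, C i j * (u j * x j)
            ≤ ∑ j with c j = k, C i (g k) * (u j * x j) :=
              Finset.sum_le_sum fun j hj => mul_le_mul_of_nonneg_right
                (hgm k j (Finset.mem_filter.1 hj).2) (hy0 j)
          _ ≤ C i (g k) := by
              rw [← Finset.mul_sum]
              exact mul_le_of_le_one_right (h.nonneg _ _) (hs k)
      · intro j hj
        have : x j = 0 := by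
          by_contra hne
          exact hi j (hxB j hne) (Finset.mem_filter.1 hj).2
        simp [this]
    rw [hy i] at h1
    exact absurd (h.sum_erase_lt hg i) (not_lt.2 h1)
  choose g hgB hg using key
  have hinj : Function.Injective g := fun a a' haa => by rw [← hg a, haa, hg]
  have hcard : B.card = n := by simpa using (Fintype.card_congr e).symm
  have himg : Finset.univ.image g = B := by
    refine Finset.eq_of_subset_of_card_le (Finset.image_subset_iff.2 fun i _ => hgB i) ?_
    rw [Finset.card_image_of_injective _ hinj, hcard, Finset.card_univ, Fintype.card_fin]
  refine ⟨g, hg, fun j => ⟨fun hj => ?_, fun hj => hj ▸ hgB _⟩⟩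
  rw [← himg] at hj
  obtain ⟨i, -, rfl⟩ := Finset.mem_image.1 hj
  rw [hg]

theorem sum_section [Fintype κ] {B : Finset κ} {g : Fin n → κ} (hg : ∀ i, c (g i) = i)
    (hB : ∀ j, j ∈ B ↔ g (c j) = j) {f : κ → ℝ} (hf : ∀ j, j ∉ B → f j = 0) :
    ∑ j, f j = ∑ i, f (g i) := by
  classical
  have hinj : Function.Injective g := fun a a' haa => by rw [← hg a, haa, hg]
  rw [← Finset.sum_image (s := Finset.univ) (g := g) (f := f) hinj.injOn]
  refine (Finset.sum_subset (Finset.subset_univ _) fun j _ hj => hf j fun hjB => hj ?_).symm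
  exact Finset.mem_image.2 ⟨c j, Finset.mem_univ _, (hB j).1 hjB⟩

theorem basicSolution_pos [Fintype κ] (h : IsDominant A b C u c) {B : Finset κ}
    {g : Fin n → κ} (hg : ∀ i, c (g i) = i) (hB : ∀ j, j ∈ B ↔ g (c j) = j) {x : κ → ℝ}
    (hx : IsBasicSolution A b B x) {j : κ} (hj : j ∈ B) : 0 < x j := by
  have hpos : ∀ i, 0 < u (g i) * x (g i) := by
    refine pos_of_mulVec_eq_one (D := C.submatrix id g) (fun i k => h.nonneg _ _)
      (fun i => ?_) (h.sum_lt g hg) (y := fun i => u (g i) * x (g i)) fun i => ?_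
    · simpa [hg] using h.eq_one (g i)
    · have h1 := congrFun hx.1 i
      simp only [Matrix.mulVec, dotProduct, h.eq, mul_assoc, ← Finset.mul_sum] at h1
      rw [sum_section hg hB] at h1
      · exact mul_left_cancel₀ (h.b_pos i).ne' (h1.trans (mul_one _).symm)
      · intro j hj
        rw [not_not.1 fun hne => hj (hx.2 j hne)]
        simp
  have := hpos (c j)
  rw [(hB j).1 hj] at this
  exact pos_of_mul_pos_right this (h.u_pos j).le

/-- Up to diagonal scalings, the submatrix is strictly diagonally dominant, hence nonsingular;
nonnegativity of its basic solution comes from `basicSolution_pos`. -/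
theorem feasible_of_transversal [Fintype κ] (h : IsDominant A b C u c) {B : Finset κ}
    (hB : Transversal c B) : IsFeasibleBasis A b B := by
  classical
  obtain ⟨g, hg, hB⟩ := hB
  have hdet : (A.submatrix id g).det ≠ 0 := by
    have hA : A.submatrix id g
        = Matrix.diagonal b * C.submatrix id g * Matrix.diagonal (fun k => u (g k)) := by
      ext i k
      simp [Matrix.mul_diagonal, Matrix.diagonal_mul, h.eq]
    rw [hA, Matrix.det_mul, Matrix.det_mul, Matrix.det_diagonal, Matrix.det_diagonal]
    refine mul_ne_zero (mul_ne_zero (Finset.prod_pos fun i _ => h.b_pos i).ne' ?_)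
      (Finset.prod_pos fun i _ => h.u_pos _).ne'
    refine det_ne_zero_of_sum_row_lt_diag fun i => ?_
    have h1 := h.eq_one (g i)
    rw [hg] at h1
    simp only [Matrix.submatrix_apply, id, Real.norm_eq_abs, h1, abs_one,
      abs_of_nonneg (h.nonneg _ _)]
    exact h.sum_erase_lt hg i
  have hunit : IsUnit (A.submatrix id g).det := isUnit_iff_ne_zero.2 hdet
  have hgB : ∀ i, g i ∈ B := fun i => (hB _).2 (by rw [hg])
  refine ⟨⟨⟨fun i => ⟨g i, hgB i⟩, fun j => c j, hg, fun j => Subtype.ext ((hB _).1 j.2)⟩, hunit⟩,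
    ?_⟩
  let y := (A.submatrix id g)⁻¹.mulVec b
  have hy : (A.submatrix id g).mulVec y = b := by
    simp [y, Matrix.mulVec_mulVec, Matrix.mul_nonsing_inv _ hunit]
  let x : κ → ℝ := fun j => if j ∈ B then y (c j) else 0
  have hx : IsBasicSolution A b B x := by
    refine ⟨?_, fun j hj => not_not.1 fun hjB => hj (if_neg hjB)⟩
    rw [← hy]
    ext i
    simp only [Matrix.mulVec, dotProduct]
    rw [sum_section hg hB (fun j hj => by simp [x, hj])]
    simp [x, hgB, hg]
  refine ⟨x, hx, fun j => ?_⟩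
  by_cases hj : j ∈ B
  · exact (h.basicSolution_pos hg hB hx hj).le
  · simp [x, hj]

theorem feasible_iff [Fintype κ] (h : IsDominant A b C u c) (B : Finset κ) :
    IsFeasibleBasis A b B ↔ Transversal c B :=
  ⟨h.transversal_of_feasible, h.feasible_of_transversal⟩

theorem isNondegenerate [Fintype κ] (h : IsDominant A b C u c) : IsNondegenerate A b := by
  intro B hB x hx j
  obtain ⟨g, hg, hgB⟩ := h.transversal_of_feasible hB
  exact ⟨hx.2 j, fun hj => (h.basicSolution_pos hg hgB hx hj).ne'⟩

/-! ### The logarithmic image of a dominant system -/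

/-- The factor `b i` cancels and `u j` only shifts the column by a constant, so comparing rows
within a column amounts to comparing entries of `C`. -/
theorem tropSub_tropLog (h : IsDominant A b C u c) (i : Fin n) (j : κ) :
    tropSub (tropLog (b i)) (tropLog (A i j)) =
      if C i j = 0 then ⊤ else ((-Real.log (C i j) - Real.log (u j) : ℝ) : EReal) := by
  have hb := h.b_pos i
  have hu := h.u_pos j
  by_cases h0 : C i j = 0
  · simp [h.eq, h0, tropLog, tropSub]
  · have hC : 0 < C i j := lt_of_le_of_ne (h.nonneg i j) (Ne.symm h0)
    have hA : 0 < b i * C i j * u j := by positivity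
    rw [if_neg h0, h.eq, tropLog, tropLog, if_neg hb.not_ge, if_neg hA.not_ge,
      Real.log_mul (by positivity) hu.ne', Real.log_mul hb.ne' h0]
    simp only [tropSub]
    congr 1
    ring

theorem tropSub_lt (h : IsDominant A b C u c) {k : Fin n} {j : κ} (hk : k ≠ c j) :
    tropSub (tropLog (b (c j))) (tropLog (A (c j) j))
      < tropSub (tropLog (b k)) (tropLog (A k j)) := by
  rw [h.tropSub_tropLog, h.tropSub_tropLog, h.eq_one, if_neg one_ne_zero]
  by_cases h0 : C k j = 0
  · rw [if_pos h0]
    exact EReal.coe_lt_top _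
  · rw [if_neg h0, EReal.coe_lt_coe_iff, Real.log_one]
    have := Real.log_neg (lt_of_le_of_ne (h.nonneg k j) (Ne.symm h0)) (h.lt_one hk)
    linarith

theorem tropSub_ne (h : IsDominant A b C u c) (j : κ) :
    tropSub (tropLog (b (c j))) (tropLog (A (c j) j)) ≠ ⊥ ∧
      tropSub (tropLog (b (c j))) (tropLog (A (c j) j)) ≠ ⊤ := by
  rw [h.tropSub_tropLog, h.eq_one, if_neg one_ne_zero]
  exact ⟨EReal.coe_ne_bot _, EReal.coe_ne_top _⟩

/-- Since row `c j` is the only minimizer for column `j`, an admissible bijection is the same thing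
as a section of `c`. -/
theorem tropicalBasis_iff (h : IsDominant A b C u c) (B : Finset κ) :
    IsTropicalBasis (A.map tropLog) (fun i => tropLog (b i)) B ↔ Transversal c B := by
  constructor
  · rintro ⟨φ, hφ⟩
    have hc : ∀ i, c (φ i) = i := fun i => by
      by_contra hne
      exact absurd ((hφ i).2 (c (φ i))) (not_le.2 (h.tropSub_lt (Ne.symm hne)))
    refine ⟨fun i => φ i, hc, fun j => ⟨fun hj => ?_, fun hj => hj ▸ (φ (c j)).2⟩⟩
    obtain ⟨i, hi⟩ := φ.surjective ⟨j, hj⟩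
    obtain rfl : (φ i : κ) = j := by rw [hi]
    simp only [hc]
  · rintro ⟨g, hg, hB⟩
    refine ⟨⟨fun i => ⟨g i, (hB _).2 (by rw [hg])⟩, fun j => c j, hg,
      fun j => Subtype.ext ((hB _).1 j.2)⟩, fun i => ?_⟩
    have hne := (h.tropSub_ne (g i)).2
    have hle : ∀ k, tropSub (tropLog (b (c (g i)))) (tropLog (A (c (g i)) (g i)))
        ≤ tropSub (tropLog (b k)) (tropLog (A k (g i))) := fun k => by
      by_cases hk : k = c (g i)
      · rw [hk]
      · exact (h.tropSub_lt hk).le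
    rw [hg] at hne hle
    exact ⟨hne, hle⟩

theorem isTropicallyNondegenerate (h : IsDominant A b C u c) :
    IsTropicallyNondegenerate (A.map tropLog) (fun i => tropLog (b i)) := fun _ _ j _ =>
  ⟨c j, (h.tropSub_ne j).1, (h.tropSub_ne j).2, fun _ hk => h.tropSub_lt hk⟩

end IsDominant

/-! ### The dominance condition for the Nash equilibrium complementarity problem -/

theorem tropSlackMatrix_logMatrix {n : ℕ} (M : Matrix (Fin n) (Fin n) ℝ) :
    tropSlackMatrix (logMatrix M) = (slackMatrix M).map tropLog := by
  ext i j
  rcases j with j | j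
  · by_cases hij : i = j
    · simp [tropSlackMatrix, slackMatrix, tropLog, hij, not_le.2 (zero_lt_one (α := ℝ))]
    · simp [tropSlackMatrix, slackMatrix, tropLog, hij]
  · simp [tropSlackMatrix, slackMatrix, logMatrix]

theorem submatrixCoversPerm_of_section {n : ℕ} {κ : Type*} {C : Matrix (Fin n) κ ℝ}
    (h0 : ∀ i j, 0 ≤ C i j) (f : Fin n ↪ κ) (h1 : ∀ i, C i (f i) = 1) :
    SubmatrixCoversPerm C f := by
  refine ⟨1, fun i k => ?_⟩
  by_cases hik : i = k
  · subst hik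
    simp [h1]
  · simp [hik, h0]

theorem exists_isDominant {n : ℕ} {M : Matrix (Fin n) (Fin n) ℝ} {q : Fin n → ℝ}
    (hinst : IsInstance M q) (hdom : SystemDominance (slackMatrix M) q) :
    ∃ (C : Matrix (Fin n) (Fin n ⊕ Fin n) ℝ) (u : Fin n ⊕ Fin n → ℝ) (c : Fin n ⊕ Fin n → Fin n),
      IsDominant (slackMatrix M) q C u c ∧ ∀ k, c (Sum.inl k) = k := by
  obtain ⟨⟨hC, h1⟩, -, hsum⟩ := hdom
  choose c hc using h1
  have hA : ∀ i j, 0 ≤ slackMatrix M i j := by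
    rintro i (j | j)
    · simp only [slackMatrix, Matrix.fromCols_apply_inl, Matrix.one_apply]
      split_ifs <;> norm_num
    · simpa [slackMatrix] using hinst.nonpos i j
  have hu : ∀ j, 0 < ⨆ k, (q k)⁻¹ * slackMatrix M k j := fun j => by
    have h2 := hc j
    simp only [normalized, Matrix.of_apply] at h2
    refine inv_pos.1 (pos_of_mul_pos_right (h2 ▸ one_pos) ?_)
    exact mul_nonneg (inv_nonneg.2 (hinst.pos _).le) (hA _ _)
  -- Blue column `k` vanishes outside row `k`, so its entry `1` can only be there.
  have hinl : ∀ k, c (Sum.inl k) = k := fun k => by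
    by_contra hne
    have h2 := hc (Sum.inl k)
    simp [normalized, slackMatrix, hne] at h2
  refine ⟨normalized (slackMatrix M) q, fun j => ⨆ k, (q k)⁻¹ * slackMatrix M k j, c,
    ⟨hinst.pos, hu, fun i j => ?_, fun i j => (hC i j).1, fun i j => (hC i j).2, hc,
      fun k => ⟨_, hinl k⟩, fun g hg i => ?_⟩, hinl⟩
  · have h3 := (hu j).ne'
    have h4 := (hinst.pos i).ne'
    simp only [normalized, Matrix.of_apply]
    rw [← mul_assoc, mul_inv_cancel_left₀ h4, inv_mul_cancel_right₀ h3]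
  · refine hsum ⟨g, fun a a' haa => by rw [← hg a, haa, hg]⟩
      (submatrixCoversPerm_of_section (fun i j => (hC i j).1) _ fun k => ?_) i
    have := hc (g k)
    rwa [hg] at this

/-! ### The Lemke--Howson algorithm on transversals -/

theorem Loop.unique {n : ℕ} {P : Finset (Fin n ⊕ Fin n) → Prop} {B : Finset (Fin n ⊕ Fin n)}
    {γ : Fin n ⊕ Fin n} {L L' : List (Finset (Fin n ⊕ Fin n))} (h : Loop P B γ L)
    (h' : Loop P B γ L') : L' = L := by
  have piv : ∀ {B γ B₁ B₂ δ₁ δ₂}, Pivot P B γ B₁ δ₁ → Pivot P B γ B₂ δ₂ → B₁ = B₂ ∧ δ₁ = δ₂ := by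
    intro B γ B₁ B₂ δ₁ δ₂ h₁ h₂
    have hB : B₁ = B₂ := (h₂.1 B₁).1 ((h₁.1 B₁).2 rfl)
    subst hB
    exact ⟨rfl, Finset.singleton_injective (h₁.2.symm.trans h₂.2)⟩
  induction h generalizing L' with
  | halt hp hf =>
    cases h' with
    | halt hp' hf' => rw [(piv hp hp').1]
    | next hp' hf' _ => exact absurd ((piv hp hp').1 ▸ hf) hf'
  | next hp hf _ ih =>
    cases h' with
    | halt hp' hf' => exact absurd ((piv hp hp').1 ▸ hf') hf
    | next hp' hf' hl' =>
      obtain ⟨rfl, rfl⟩ := piv hp hp'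
      rw [ih hl']

/-- The loop entered with `B` and `γ` stops after at most `N` iterations, at a fully labeled basis
that contains a red element. -/
def Reaches {n : ℕ} (P : Finset (Fin n ⊕ Fin n) → Prop) (B : Finset (Fin n ⊕ Fin n))
    (γ : Fin n ⊕ Fin n) (N : ℕ) : Prop :=
  ∃ L, Loop P B γ L ∧ L.length ≤ N ∧
    ∃ B', L.getLast? = some B' ∧ P B' ∧ FullyLabeled B' ∧ ∃ k, Sum.inr k ∈ B'

theorem Reaches.of_halt {n : ℕ} {P : Finset (Fin n ⊕ Fin n) → Prop}
    {B B' : Finset (Fin n ⊕ Fin n)} {γ δ k} {N : ℕ} (hp : Pivot P B γ B' δ)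
    (hf : FullyLabeled B') (hk : Sum.inr k ∈ B') (hN : 1 ≤ N) : Reaches P B γ N :=
  ⟨[B'], .halt hp hf, hN, B', rfl, ((hp.1 B').2 rfl).1, hf, k, hk⟩

theorem Reaches.of_next {n : ℕ} {P : Finset (Fin n ⊕ Fin n) → Prop}
    {B B' : Finset (Fin n ⊕ Fin n)} {γ δ} {N : ℕ} (hp : Pivot P B γ B' δ)
    (hf : ¬ FullyLabeled B') (h : Reaches P B' δ.swap N) : Reaches P B γ (N + 1) := by
  obtain ⟨L, hL, hN, B₁, hlast, hB₁⟩ := h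
  refine ⟨B' :: L, .next hp hf hL, by simpa using hN, B₁, ?_, hB₁⟩
  rw [List.getLast?_cons, hlast]
  rfl

theorem Reaches.mono {n : ℕ} {P : Finset (Fin n ⊕ Fin n) → Prop}
    {B : Finset (Fin n ⊕ Fin n)} {γ} {N N' : ℕ} (h : Reaches P B γ N) (hN : N ≤ N') :
    Reaches P B γ N' := by
  obtain ⟨L, hL, hlen, h⟩ := h
  exact ⟨L, hL, hlen.trans hN, h⟩

section Sections

variable {n : ℕ} {c : Fin n ⊕ Fin n → Fin n} {g : Fin n → Fin n ⊕ Fin n}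

theorem mem_image_section (hg : ∀ i, c (g i) = i) (j : Fin n ⊕ Fin n) :
    j ∈ Finset.univ.image g ↔ g (c j) = j := by
  refine ⟨fun h => ?_, fun h => h ▸ Finset.mem_image_of_mem g (Finset.mem_univ _)⟩
  obtain ⟨i, -, rfl⟩ := Finset.mem_image.1 h
  rw [hg]

theorem update_section (hg : ∀ i, c (g i) = i) (γ : Fin n ⊕ Fin n) (i : Fin n) :
    c (Function.update g (c γ) γ i) = i := by
  by_cases hi : i = c γ
  · subst hi; simp
  · simp [hi, hg i]

theorem transversal_image (hg : ∀ i, c (g i) = i) : Transversal c (Finset.univ.image g) :=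
  ⟨g, hg, mem_image_section hg⟩

/-- After adding `γ`, only the fiber over `c γ` has two elements, so the sole other transversal
keeps `γ` in that fiber and drops its former occupant. -/
theorem pivot_update (hg : ∀ i, c (g i) = i) {γ : Fin n ⊕ Fin n} (hγ : g (c γ) ≠ γ) :
    Pivot (Transversal c) (Finset.univ.image g) γ
      (Finset.univ.image (Function.update g (c γ) γ)) (g (c γ)) := by
  have hg' := update_section hg γ
  constructor
  · intro B
    constructor
    · rintro ⟨⟨f, hf, hB⟩, hsub, hne⟩
      have hBf : B = Finset.univ.image f := by
        ext j
        rw [hB, mem_image_section hf]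
      subst hBf
      have hfi : ∀ i, i ≠ c γ → f i = g i := fun i hi => by
        rcases Finset.mem_insert.1 (hsub (Finset.mem_image_of_mem f (Finset.mem_univ i))) with h | h
        · exact absurd (by rw [← h, hf]) hi
        · have := (mem_image_section hg _).1 h
          rwa [hf, eq_comm] at this
      have hfγ : f (c γ) = γ := by
        rcases Finset.mem_insert.1
          (hsub (Finset.mem_image_of_mem f (Finset.mem_univ (c γ)))) with h | h
        · exact h
        · have h2 := (mem_image_section hg _).1 h
          rw [hf] at h2
          refine absurd ?_ hne
          congr 1
          ext1 i
          by_cases hi : i = c γ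
          · rw [hi, h2]
          · exact hfi i hi
      congr 1
      ext1 i
      by_cases hi : i = c γ
      · rw [hi, hfγ, Function.update_self]
      · rw [hfi i hi, Function.update_of_ne hi]
    · rintro rfl
      refine ⟨transversal_image hg', fun j hj => ?_, fun heq => hγ ?_⟩
      · obtain ⟨i, -, rfl⟩ := Finset.mem_image.1 hj
        by_cases hi : i = c γ
        · subst hi; simp
        · simp [hi]
      · rw [← mem_image_section hg, ← heq, mem_image_section hg', Function.update_self]
  · ext j
    rw [Finset.mem_sdiff, mem_image_section hg, mem_image_section hg', Finset.mem_singleton]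
    by_cases hj : c j = c γ
    · rw [hj, Function.update_self]
      exact ⟨fun h => h.1.symm, fun h => ⟨h.symm, fun h' => hγ (by rw [← h, h'])⟩⟩
    · rw [Function.update_of_ne hj]
      exact ⟨fun h => absurd h.1 h.2, fun h => absurd (by rw [h, hg]) hj⟩

variable {p : ℕ → Fin n}

/-- The blue elements `p v, …, p 1` enter successively. -/
theorem reaches_walk_back (hinl : ∀ k, c (Sum.inl k) = k)
    (hp : ∀ i, c (Sum.inr (p i)) = p (i + 1)) (v : ℕ) :
    ∀ g : Fin n → Fin n ⊕ Fin n, (∀ i, c (g i) = i) → Set.InjOn p (Set.Iic (v + 1)) →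
      (∀ i ≤ v, g (p (i + 1)) = Sum.inr (p i)) → g (p 0) = Sum.inl (p 0) →
      (∀ k, k ≠ p (v + 1) → g k = Sum.inl k ∨ g (c (Sum.inr k)) = Sum.inr k) →
      (∃ k, g (c (Sum.inr k)) = Sum.inr k ∧ ∀ i ≤ v, c (Sum.inr k) ≠ p (i + 1)) →
      Reaches (Transversal c) (Finset.univ.image g) (Sum.inl (p (v + 1))) (v + 1) := by
  induction v with
  | zero =>
    intro g hg hinj hgp hg0 hlab hred
    have hpiv := pivot_update hg (γ := Sum.inl (p 1)) (by
      rw [hinl, hgp 0 le_rfl]; exact Sum.inr_ne_inl)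
    have hg' := update_section hg (Sum.inl (p 1))
    have h01 : p 0 ≠ p 1 := fun h => by
      simpa using hinj (by simp : (0 : ℕ) ∈ _) (by simp : (1 : ℕ) ∈ _) h
    -- The leaving element is `inr (p 0)`, whose blue twin is already present, so all labels occur.
    -- The red element `inr k` lies outside the rows being emptied and survives.
    obtain ⟨k, hk, hk'⟩ := hred
    refine .of_halt hpiv (k := k) (fun k => ?_) ?_ le_rfl
    · rw [mem_image_section hg', mem_image_section hg', hinl, hinl]
      by_cases hk1 : k = p 1
      · subst hk1; simp
      rw [Function.update_of_ne hk1]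
      by_cases hk0 : k = p 0
      · subst hk0; exact .inl hg0
      refine (hlab k hk1).imp id fun h => ?_
      rwa [Function.update_of_ne]
      intro h2
      rw [h2, hgp 0 le_rfl] at h
      exact hk0 (Sum.inr_injective h).symm
    · rw [mem_image_section hg', hinl, Function.update_of_ne (hk' 0 le_rfl), hk]
  | succ v ih =>
    intro g hg hinj hgp hg0 hlab hred
    have hpiv := pivot_update hg (γ := Sum.inl (p (v + 2))) (by
      rw [hinl, hgp (v + 1) le_rfl]; exact Sum.inr_ne_inl)
    have hg' := update_section hg (Sum.inl (p (v + 2)))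
    rw [hinl] at hpiv hg'
    have hne : ∀ i ≤ v + 1, p i ≠ p (v + 2) := fun i hi h => by
      have := hinj (by simp; omega : i ∈ _) (by simp : v + 2 ∈ _) h
      omega
    have hgp' : ∀ i ≤ v, Function.update g (p (v + 2)) (Sum.inl (p (v + 2))) (p (i + 1))
        = Sum.inr (p i) := fun i hi => by
      rw [Function.update_of_ne (hne _ (by omega)), hgp i (by omega)]
    refine .of_next hpiv (fun hf => ?_) ?_
    -- Label `p (v + 1)` is missing: its blue row still holds `inr (p v)`, and its red copy has just
    -- left.
    · have := hf (p (v + 1))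
      rw [mem_image_section hg', mem_image_section hg', hinl, hp, hgp' v le_rfl] at this
      simp at this
    · rw [hgp (v + 1) le_rfl, Sum.swap_inr]
      refine ih _ hg' (hinj.mono (Set.Iic_subset_Iic.2 (by omega))) hgp' ?_ ?_ ?_
      · rw [Function.update_of_ne (hne _ (by omega)), hg0]
      · intro k hk
        by_cases hk2 : k = p (v + 2)
        · subst hk2; simp
        rw [Function.update_of_ne hk2]
        refine (hlab k hk2).imp id fun h => ?_
        rwa [Function.update_of_ne]
        intro h2
        rw [h2, hgp (v + 1) le_rfl] at h
        exact hk (Sum.inr_injective h).symm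
      · obtain ⟨k, hk, hk'⟩ := hred
        refine ⟨k, ?_, fun i hi => hk' i (by omega)⟩
        rw [Function.update_of_ne (hk' (v + 1) le_rfl), hk]

/-- The red elements `p 0, …, p (t - 1)` have entered successively, and `p t` is entering. -/
theorem reaches_forward (hinl : ∀ k, c (Sum.inl k) = k)
    (hp : ∀ i, c (Sum.inr (p i)) = p (i + 1)) (d : ℕ) :
    ∀ (t : ℕ) (g : Fin n → Fin n ⊕ Fin n), t + d = n → (∀ i, c (g i) = i) →
      Set.InjOn p (Set.Iic t) → (∀ i < t, g (p (i + 1)) = Sum.inr (p i)) →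
      (∀ k, (∀ i < t, k ≠ p (i + 1)) → g k = Sum.inl k) →
      Reaches (Transversal c) (Finset.univ.image g) (Sum.inr (p t)) (n + d - 1) := by
  induction d with
  | zero =>
    intro t g ht hg hinj
    -- Here `t = n`, and `p` would take `n + 1` distinct values in `Fin n`.
    have := Finset.card_le_univ ((Finset.Iic t).image p)
    rw [Finset.card_image_of_injOn (by simpa using hinj), Nat.card_Iic, Fintype.card_fin] at this
    omega
  | succ d ih =>
    intro t g ht hg hinj hred hblue
    have hinj' : ∀ {i j}, i ≤ t → j ≤ t → p i = p j → i = j := fun hi hj h => hinj hi hj h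
    have hval : ∀ k, g k = Sum.inl k ∨ ∃ i < t, k = p (i + 1) ∧ g k = Sum.inr (p i) := fun k => by
      by_cases h : ∃ i < t, k = p (i + 1)
      · obtain ⟨i, hi, rfl⟩ := h
        exact .inr ⟨i, hi, rfl, hred i hi⟩
      · exact .inl (hblue k fun i hi hk => h ⟨i, hi, hk⟩)
    have hpiv := pivot_update hg (γ := Sum.inr (p t)) (by
      rcases hval (c (Sum.inr (p t))) with h | ⟨i, hi, -, h⟩
      · rw [h]; exact Sum.inl_ne_inr
      · rw [h]
        intro h'
        have := hinj' hi.le le_rfl (Sum.inr_injective h')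
        omega)
    have hg' := update_section hg (Sum.inr (p t))
    rw [hp] at hpiv hg'
    have hself : Function.update g (p (t + 1)) (Sum.inr (p t)) (p (t + 1)) = Sum.inr (p t) :=
      Function.update_self ..
    -- The orbit closes at its start: `inl (p 0)` leaves while `inr (p 0)` is present, so all labels
    -- occur.
    by_cases h0 : p (t + 1) = p 0
    · refine .of_halt hpiv (k := p t) (fun k => ?_) ?_ (by omega)
      · rw [mem_image_section hg', mem_image_section hg', hinl]
        by_cases hk : ∃ i ≤ t, k = p i
        · obtain ⟨i, hi, rfl⟩ := hk
          right
          rw [hp]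
          rcases hi.lt_or_eq with hi | rfl
          · rw [Function.update_of_ne, hred i hi]
            intro h
            have := hinj' hi (Nat.zero_le _) (h.trans h0)
            omega
          · exact hself
        · left
          rw [Function.update_of_ne fun h => hk ⟨0, Nat.zero_le _, h.trans h0⟩]
          exact hblue k fun i hi h => hk ⟨i + 1, hi, h⟩
      · rw [mem_image_section hg', hp, hself]
    have hg0 : g (p 0) = Sum.inl (p 0) := hblue _ fun i hi h => by
      have := hinj' (Nat.zero_le _) hi h
      omega
    have hg0' : Function.update g (p (t + 1)) (Sum.inr (p t)) (p 0) = Sum.inl (p 0) := by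
      rw [Function.update_of_ne (Ne.symm h0), hg0]
    -- The orbit meets itself at `p (s + 1)`: row `p (s + 1)` is occupied by `inr (p s)`, which
    -- leaves, and `inl (p s)` enters next unless `s = 0`.
    by_cases hs : ∃ s < t, p (t + 1) = p (s + 1)
    · obtain ⟨s, hst, hs⟩ := hs
      rw [hs] at hpiv hg' hself hg0'
      have hred' : ∀ i < t, i ≠ s →
          Function.update g (p (s + 1)) (Sum.inr (p t)) (p (i + 1)) = Sum.inr (p i) :=
        fun i hi his => by
          rw [Function.update_of_ne, hred i hi]
          intro h
          have := hinj' hi hst h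
          omega
      have hlab : ∀ k, k ≠ p s → Function.update g (p (s + 1)) (Sum.inr (p t)) k = Sum.inl k ∨
          Function.update g (p (s + 1)) (Sum.inr (p t)) (c (Sum.inr k)) = Sum.inr k := by
        intro k hk
        by_cases hki : ∃ i ≤ t, k = p i
        · obtain ⟨i, hi, rfl⟩ := hki
          right
          rw [hp]
          rcases hi.lt_or_eq with hi | rfl
          · exact hred' i hi fun h => hk (by rw [h])
          · rw [hs, hself]
        · left
          rw [Function.update_of_ne fun h => hki ⟨s + 1, hst, h⟩]
          exact hblue k fun i hi h => hki ⟨i + 1, hi, h⟩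
      rcases s with _ | s
      · refine .of_halt hpiv (k := p t) (fun k => ?_) ?_ (by omega)
        · rw [mem_image_section hg', mem_image_section hg', hinl]
          by_cases hk : k = p 0
          · subst hk; exact .inl hg0'
          · exact hlab k hk
        · rw [mem_image_section hg', hp, hs, hself]
      -- One pivot, then at most `s + 1` more to undo the tail of the orbit; `inr (p t)` stays in
      -- the basis throughout.
      · have hR : Reaches (Transversal c) _ _ (s + 1 + 1) := .of_next hpiv (fun hf => ?_) ?_
        · exact hR.mono (by omega)
        · have := hf (p (s + 1))
          rw [mem_image_section hg', mem_image_section hg', hinl, hp, hself,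
            hred' s (by omega) (by omega)] at this
          rcases this with h | h
          · exact Sum.inr_ne_inl h
          · have := hinj' le_rfl (by omega) (Sum.inr_injective h)
            omega
        · rw [hred (s + 1) hst, Sum.swap_inr]
          refine reaches_walk_back hinl hp s _ hg'
            (hinj.mono (Set.Iic_subset_Iic.2 (by omega)))
            (fun i hi => hred' i (by omega) (by omega)) hg0' hlab
            ⟨p t, by rw [hp, hs, hself], fun i hi h => ?_⟩
          rw [hp, hs] at h
          have := hinj' (by omega) (by omega) h
          omega
    · have hfresh : ∀ i ≤ t, p (t + 1) ≠ p i := fun i hi h => by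
        rcases i with _ | i
        · exact h0 h
        · exact hs ⟨i, hi, h⟩
      have hgt : g (p (t + 1)) = Sum.inl (p (t + 1)) :=
        hblue _ fun i hi h => hfresh (i + 1) hi h
      rw [show n + (d + 1) - 1 = (n + d - 1) + 1 by omega]
      refine .of_next hpiv (fun hf => ?_) ?_
      -- At a fresh orbit point, `inl (p (t + 1))` has just left and its red twin has not yet
      -- entered, so its label is missing.
      · have := hf (p (t + 1))
        rw [mem_image_section hg', mem_image_section hg', hinl, hself] at this
        rcases this with h | h
        · exact Sum.inr_ne_inl h
        · by_cases hc : c (Sum.inr (p (t + 1))) = p (t + 1)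
          · rw [hc, hself] at h
            exact hfresh t le_rfl (Sum.inr_injective h).symm
          · rw [Function.update_of_ne hc] at h
            rcases hval (c (Sum.inr (p (t + 1)))) with h' | ⟨i, hi, -, h'⟩
            · rw [h'] at h
              exact Sum.inl_ne_inr h
            · rw [h'] at h
              exact hfresh i hi.le (Sum.inr_injective h).symm
      · rw [hgt, Sum.swap_inl]
        refine ih (t + 1) _ (by omega) hg' ?_ (fun i hi => ?_) fun k hk => ?_
        · intro i hi j hj hij
          simp only [Set.mem_Iic] at hi hj
          rcases Nat.le_succ_iff.1 hi with hi | rfl <;> rcases Nat.le_succ_iff.1 hj with hj | rfl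
          · exact hinj' hi hj hij
          · exact absurd hij.symm (hfresh i hi)
          · exact absurd hij (hfresh j hj)
          · rfl
        · rcases Nat.lt_succ_iff_lt_or_eq.1 hi with hi | rfl
          · rw [Function.update_of_ne (hfresh (i + 1) hi).symm, hred i hi]
          · exact hself
        · rw [Function.update_of_ne (hk t (by omega))]
          exact hblue k fun i hi => hk i (by omega)

/-- A transversal has `n` elements, so the map from rows to labels, being onto the `n` labels, is
injective. -/
theorem not_both_mem_of_fullyLabeled {B : Finset (Fin n ⊕ Fin n)} (hB : Transversal c B)
    (hf : FullyLabeled B) (k : Fin n) : ¬ (Sum.inl k ∈ B ∧ Sum.inr k ∈ B) := by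
  obtain ⟨g, hg, hgB⟩ := hB
  have hsurj : Function.Surjective fun i => Sum.elim id id (g i) := fun k => by
    rcases hf k with h | h
    · exact ⟨c (Sum.inl k), by simp only [(hgB _).1 h]; rfl⟩
    · exact ⟨c (Sum.inr k), by simp only [(hgB _).1 h]; rfl⟩
  have hinj := Finite.injective_iff_surjective.2 hsurj
  rintro ⟨h1, h2⟩
  rw [hgB] at h1 h2
  have := @hinj (c (Sum.inl k)) (c (Sum.inr k)) (by simp only [h1, h2]; rfl)
  rw [← this, h1] at h2
  exact Sum.inl_ne_inr h2

end Sections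

end NashCP

theorem mainTheorem6 {n : ℕ} (M : Matrix (Fin n) (Fin n) ℝ) (q : Fin n → ℝ)
    (hinst : IsInstance M q) (hdom : SystemDominance (slackMatrix M) q) (jstar : Fin n) :
    IsNondegenerate (slackMatrix M) q ∧
    IsTropicallyNondegenerate (tropSlackMatrix (logMatrix M)) (logVector q) ∧
    ∃ L : List (Finset (Fin n ⊕ Fin n)),
      (∀ L', LemkeHowson (IsFeasibleBasis (slackMatrix M) q) jstar L' ↔ L' = L) ∧
      (∀ L', LemkeHowson (IsTropicalBasis (tropSlackMatrix (logMatrix M)) (logVector q))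
        jstar L' ↔ L' = L) ∧
      L.length ≤ 2 * n - 1 ∧
      ∃ B, L.getLast? = some B ∧
        IsFeasibleBasis (slackMatrix M) q B ∧
        ∃ w z : Fin n → ℝ, IsBasicSolution (slackMatrix M) q B (Sum.elim w z) ∧
          IsSolution M q w z := by
  obtain ⟨C, u, c, h, hinl⟩ := exists_isDominant hinst hdom
  rw [tropSlackMatrix_logMatrix]
  refine ⟨h.isNondegenerate, h.isTropicallyNondegenerate, ?_⟩
  have hP : IsFeasibleBasis (slackMatrix M) q = Transversal c :=
    funext fun B => propext (h.feasible_iff B)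
  have hT : IsTropicalBasis ((slackMatrix M).map tropLog) (logVector q) = Transversal c :=
    funext fun B => propext (h.tropicalBasis_iff B)
  have hinit : initialBasis n = Finset.univ.image Sum.inl := by
    ext j
    simp [initialBasis]
  -- With `t = 0` and `d = n`, the bound `n + d - 1` becomes `2 * n - 1`.
  have hreach := reaches_forward (c := c) (p := fun i => (fun k => c (Sum.inr k))^[i] jstar) hinl
    (fun i => (Function.iterate_succ_apply' (fun k => c (Sum.inr k)) i jstar).symm) n 0 Sum.inl (Nat.zero_add n) hinl
    (fun i hi j hj _ => by rw [Nat.le_zero.1 hi, Nat.le_zero.1 hj]) (by simp) (fun _ _ => rfl)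
  obtain ⟨L, hL, hlen, B, hlast, hB, hfull, k, hk⟩ := hreach
  rw [← hinit] at hL
  have hLH : ∀ L', LemkeHowson (Transversal c) jstar L' ↔ L' = L := fun L' =>
    ⟨fun h' => hL.unique h'.2, fun h' => h' ▸ ⟨hinit ▸ transversal_image hinl, hL⟩⟩
  refine ⟨L, hP ▸ hLH, hT ▸ hLH, by omega, B, hlast, hP ▸ hB, ?_⟩
  obtain ⟨-, x, hx, hx0⟩ := h.feasible_of_transversal hB
  have hsupp := h.isNondegenerate B (hP ▸ hB) x hx
  refine ⟨x ∘ Sum.inl, x ∘ Sum.inr, by rwa [Sum.elim_comp_inl_inr], ?_, ?_, ?_, fun i => hx0 _,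
    fun i => hx0 _⟩
  · have := hx.1
    rw [← Sum.elim_comp_inl_inr x, slackMatrix, Matrix.fromCols_mulVec_sumElim, Matrix.one_mulVec,
      Matrix.neg_mulVec] at this
    rw [← this]
    abel
  · refine Finset.sum_eq_zero fun i _ => ?_
    by_contra hne
    exact not_both_mem_of_fullyLabeled hB hfull i
      ⟨(hsupp _).1 (left_ne_zero_of_mul hne), (hsupp _).1 (right_ne_zero_of_mul hne)⟩
  -- By nondegeneracy, the red column remaining in the last basis has a nonzero coordinate.
  · intro hz
    exact (hsupp (Sum.inr k)).2 hk (congrFun hz k)
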